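/- All Banach spaces are real. For a Banach space $X$ with closed unit ball $B_X$, a slice of $B_X$ is a set $S(x^*;\varepsilon)=\{x\in B_X: x^*(x)>1-\varepsilon\}$ with $x^*\in X^*$, $\|x^*\|=1$, $\varepsilon>0$; $X$ has the local diameter two property if every slice of $B_X$ has diameter $2$. An Orlicz function is a convex, left-continuous $\varphi:[0,\infty)\to[0,\infty]$ with $\varphi(0)=0$ that is neither identically zero nor identically infinite on $(0,\infty)$. Its complementary function is $\varphi_*(u)=\sup_{v\ge 0}\{uv-\varphi(v)\}$. For a $\sigma$-finite measure space $(\Omega,\Sigma,\mu)$ put $I_\varphi(f)=\int_\Omega\varphi(|f|)\,d\mu$. Let $L_\varphi^0(\mu)$ be the space of (classes of) measurable $f:\Omega\to\mathbb R$ with $I_\varphi(\lambda f)<\infty$ for some $\lambda>0$, with the Orlicz norm $$\|f\|_\varphi^0=\sup\Big\{\int_\Omega fg\,d\mu:\ I_{\varphi_*}(g)\le 1\Big\}.$$ For the counting measure on $\mathbb N$ this space is denoted $\ell_\varphi^0$. For an Orlicz function $\psi$ put $$d_\psi=\sup\{u\ge 0:\ \psi(v)=kv \text{ for all } v\in[0,u],\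 \text{for some } k\ge 0\},\qquad c_\psi=\sup\{u\ge 0:\psi(u)\le 1\}.$$ **Corollary.** Let $\varphi$ be an Orlicz function with finite values that is an $N$-function at infinity, i.e. $\lim_{u\to\infty}\varphi(u)/u=\infty$. (i) If $\mu$ is a nonzero $\sigma$-finite non-atomic measure, then $B_{L_\varphi^0(\mu)}$ has a slice of diameter less than $2$; consequently $L_\varphi^0(\mu)$ does not have the local diameter two property. (ii) If $d_{\varphi_*}<c_{\varphi_*}$, then $B_{\ell_\varphi^0}$ has a slice of diameter less than $2$; consequently $\ell_\varphi^0$ does not have the local diameter two property. -/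

import Mathlib

open MeasureTheory Set Filter Topology
open scoped NNReal ENNReal

/-- An Orlicz function: convex, left-continuous, zero at the origin, and neither identically
zero nor identically infinite on the open half-line. -/
structure OrliczFunction where
  toFun : ℝ≥0 → ℝ≥0∞
  convex : ConvexOn ℝ≥0 univ toFun
  map_zero : toFun 0 = 0
  leftCont : ∀ u, ContinuousWithinAt toFun (Iic u) u
  exists_ne_zero : ∃ u, 0 < u ∧ toFun u ≠ 0
  exists_ne_top : ∃ u, 0 < u ∧ toFun u ≠ ∞

/-- The complementary function `ψ(u) = sup_{v ≥ 0} (u v - φ v)`. The term `v = 0` contributes `0`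
(when `φ 0 = 0`), so truncating the subtraction at `0` does not change the supremum. -/
noncomputable def complementary (φ : ℝ≥0 → ℝ≥0∞) (u : ℝ≥0) : ℝ≥0∞ :=
  ⨆ v : ℝ≥0, ((u : ℝ≥0∞) * (v : ℝ≥0∞) - φ v)

/-- The modular `∫ φ(|f|) dμ`. -/
noncomputable def modular {Ω : Type*} [MeasurableSpace Ω] (φ : ℝ≥0 → ℝ≥0∞) (μ : Measure Ω)
    (f : Ω → ℝ) : ℝ≥0∞ :=
  ∫⁻ t, φ ‖f t‖₊ ∂μ

/-- `d φ`: the supremum of all `u` such that `φ` is linear on `[0, u]`. -/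
noncomputable def linearityBound (φ : ℝ≥0 → ℝ≥0∞) : ℝ≥0∞ :=
  ⨆ u ∈ {u : ℝ≥0 | ∃ k : ℝ≥0, ∀ v ≤ u, φ v = (k : ℝ≥0∞) * (v : ℝ≥0∞)}, (u : ℝ≥0∞)

/-- `c φ`: the supremum of all `u` such that `φ u ≤ 1`. -/
noncomputable def unitLevelBound (φ : ℝ≥0 → ℝ≥0∞) : ℝ≥0∞ :=
  ⨆ u ∈ {u : ℝ≥0 | φ u ≤ 1}, (u : ℝ≥0∞)

/-- Every measurable set of positive measure has a measurable subset of strictly smaller positive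
measure. (Mathlib's `NoAtoms` only says that points are null sets.) -/
def IsNonatomic {Ω : Type*} [MeasurableSpace Ω] (μ : Measure Ω) : Prop :=
  ∀ A, MeasurableSet A → 0 < μ A → ∃ B, MeasurableSet B ∧ B ⊆ A ∧ 0 < μ B ∧ μ B < μ A

namespace OrliczFunction

/-- `φ` does not take the value infinity. -/
def IsFinite (φ : OrliczFunction) : Prop := ∀ u, φ.toFun u ≠ ∞

/-- `φ(u)/u → ∞` as `u → ∞`. -/
def IsNFunctionAtInfty (φ : OrliczFunction) : Prop :=
  Tendsto (fun u : ℝ≥0 => φ.toFun u / (u : ℝ≥0∞)) atTop (𝓝 ∞)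

theorem le_smul (φ : OrliczFunction) (a u : ℝ≥0) (ha : a ≤ 1) :
    φ.toFun (a * u) ≤ a * φ.toFun u := by
  have h := φ.convex.2 (mem_univ u) (mem_univ 0) zero_le zero_le
    (add_tsub_cancel_of_le ha)
  simpa [φ.map_zero, ENNReal.smul_def] using h

theorem mono (φ : OrliczFunction) : Monotone φ.toFun := by
  intro u v huv
  rcases eq_or_ne v 0 with rfl | hv
  · have : u = 0 := le_antisymm huv zero_le
    rw [this]
  · have h1 : u / v ≤ 1 := div_le_one_of_le₀ huv zero_le
    have h := φ.le_smul (u / v) v h1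
    rw [div_mul_cancel₀ _ hv] at h
    refine h.trans ?_
    calc ((u / v : ℝ≥0) : ℝ≥0∞) * φ.toFun v ≤ 1 * φ.toFun v := by
          gcongr; exact_mod_cast h1
      _ = φ.toFun v := one_mul _

theorem young (φ : OrliczFunction) (u v : ℝ≥0) :
    (u : ℝ≥0∞) * v ≤ φ.toFun u + complementary φ.toFun v := by
  have h : (v : ℝ≥0∞) * u - φ.toFun u ≤ complementary φ.toFun v :=
    le_iSup (fun w : ℝ≥0 => (v : ℝ≥0∞) * (w : ℝ≥0∞) - φ.toFun w) u
  rw [mul_comm, add_comm]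
  exact tsub_le_iff_right.1 h

theorem exists_compl_bound (φ : OrliczFunction) :
    ∃ c u : ℝ≥0, 0 < c ∧ ∀ c' ≤ c, complementary φ.toFun c' ≤ (c' : ℝ≥0∞) * u := by
  obtain ⟨u, hu, hφ⟩ := φ.exists_ne_zero
  have hm : min 1 (φ.toFun u) ≠ ∞ := ne_top_of_le_ne_top ENNReal.one_ne_top (min_le_left _ _)
  obtain ⟨m, hm'⟩ : ∃ m : ℝ≥0, (m : ℝ≥0∞) = min 1 (φ.toFun u) := ⟨_, ENNReal.coe_toNNReal hm⟩
  have hmφ : (m : ℝ≥0∞) ≤ φ.toFun u := hm' ▸ min_le_right _ _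
  have hm0 : 0 < m := by
    rw [pos_iff_ne_zero]
    rintro rfl
    have : min 1 (φ.toFun u) = 0 := by rw [← hm']; simp
    rcases min_eq_iff.1 this with h | h
    · exact one_ne_zero h.1
    · exact hφ h.1
  refine ⟨m / u, u, by positivity, fun c' hc' => iSup_le fun v => ?_⟩
  rcases le_total v u with h | h
  · exact tsub_le_self.trans (by gcongr)
  · have hv : 0 < v := hu.trans_le h
    have h1 := φ.le_smul (u / v) v (div_le_one_of_le₀ h zero_le)
    rw [div_mul_cancel₀ _ hv.ne'] at h1
    have h2 : (c' : ℝ≥0∞) * v ≤ φ.toFun v := by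
      calc (c' : ℝ≥0∞) * v ≤ ((m / u : ℝ≥0) : ℝ≥0∞) * v := by gcongr
        _ = ((v / u : ℝ≥0) : ℝ≥0∞) * m := by
            norm_cast; field_simp
        _ ≤ ((v / u : ℝ≥0) : ℝ≥0∞) * (((u / v : ℝ≥0) : ℝ≥0∞) * φ.toFun v) := by
            gcongr; exact hmφ.trans h1
        _ = φ.toFun v := by
            rw [← mul_assoc, ← ENNReal.coe_mul]
            have : v / u * (u / v) = 1 := by field_simp
            rw [this]; simp
    rw [tsub_eq_zero_of_le h2]; exact zero_le

end OrliczFunction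

section OrliczSpace

variable {Ω : Type*} [MeasurableSpace Ω]

/-- All (classes of) measurable `f` with `∫ φ(a |f|) dμ < ∞` for some `a > 0`. -/
def orliczSubmodule (φ : OrliczFunction) (μ : Measure Ω) : Submodule ℝ (Ω →ₘ[μ] ℝ) where
  carrier := {f | ∃ a : ℝ, 0 < a ∧ modular φ.toFun μ (fun t => a * f t) < ∞}
  zero_mem' := by
    refine ⟨1, one_pos, ?_⟩
    have : modular φ.toFun μ (fun t => 1 * (0 : Ω →ₘ[μ] ℝ) t) = 0 := by
      unfold modular
      rw [lintegral_congr_ae (g := fun _ => 0), lintegral_zero]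
      filter_upwards [AEEqFun.coeFn_zero (μ := μ) (β := ℝ)] with t ht
      simp [ht, φ.map_zero]
    rw [this]; exact ENNReal.zero_lt_top
  add_mem' := by
    rintro f g ⟨a, ha, hf⟩ ⟨b, hb, hg⟩
    refine ⟨min a b / 2, by positivity, ?_⟩
    have hmeas : AEMeasurable (fun t => φ.toFun ‖a * f t‖₊) μ :=
      φ.mono.measurable.comp_aemeasurable (by fun_prop)
    refine lt_of_le_of_lt ?_ (ENNReal.add_lt_top.2 ⟨hf, hg⟩)
    unfold modular
    rw [← lintegral_add_left' hmeas]
    refine lintegral_mono_ae ?_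
    filter_upwards [AEEqFun.coeFn_add f g] with t ht
    have key : ‖min a b / 2 * (f + g) t‖₊ ≤ max ‖a * f t‖₊ ‖b * g t‖₊ := by
      rw [← NNReal.coe_le_coe, NNReal.coe_max, ht]
      simp only [coe_nnnorm, Real.norm_eq_abs, abs_mul, Pi.add_apply]
      rw [abs_of_pos ha, abs_of_pos hb, abs_of_pos (by positivity : 0 < min a b / 2)]
      have h1 : min a b * |f t| ≤ a * |f t| := by gcongr; exact min_le_left _ _
      have h2 : min a b * |g t| ≤ b * |g t| := by gcongr; exact min_le_right _ _
      have h3 : min a b / 2 * |f t + g t| ≤ min a b / 2 * (|f t| + |g t|) := by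
        gcongr; exact abs_add_le _ _
      have h4 := le_max_left (a * |f t|) (b * |g t|)
      have h5 := le_max_right (a * |f t|) (b * |g t|)
      linarith
    refine (φ.mono key).trans ?_
    rw [φ.mono.map_max]
    exact max_le (le_add_right le_rfl) (le_add_left le_rfl)
  smul_mem' := by
    rintro c f ⟨a, ha, hf⟩
    refine ⟨a / (|c| + 1), by positivity, lt_of_le_of_lt ?_ hf⟩
    refine lintegral_mono_ae ?_
    filter_upwards [AEEqFun.coeFn_smul c f] with t ht
    refine φ.mono ?_
    rw [← NNReal.coe_le_coe, ht]
    simp only [coe_nnnorm, Real.norm_eq_abs, abs_mul, Pi.smul_apply, smul_eq_mul]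
    rw [abs_of_pos ha, abs_of_pos (by positivity : 0 < a / (|c| + 1))]
    have : a / (|c| + 1) * (|c| * |f t|) = a * |f t| * (|c| / (|c| + 1)) := by ring
    rw [this]
    exact mul_le_of_le_one_right (by positivity) (div_le_one_of_le₀ (by linarith) (by positivity))

/-- The Orlicz space over `μ`; below it carries the Orlicz norm. -/
def OrliczSpace (φ : OrliczFunction) (μ : Measure Ω) : Type _ := orliczSubmodule φ μ

namespace OrliczSpace

variable {φ : OrliczFunction} {μ : Measure Ω}

noncomputable instance instAddCommGroup : AddCommGroup (OrliczSpace φ μ) :=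
  inferInstanceAs (AddCommGroup (orliczSubmodule φ μ))

noncomputable instance instModule : Module ℝ (OrliczSpace φ μ) :=
  inferInstanceAs (Module ℝ (orliczSubmodule φ μ))

/-- The underlying class of measurable functions. -/
def toAEEqFun (f : OrliczSpace φ μ) : Ω →ₘ[μ] ℝ := f.1

/-- The values `∫ f g dμ`, where `g` is measurable and `∫ ψ(|g|) dμ ≤ 1` for the complementary
function `ψ` of `φ`. -/
def pairings (f : OrliczSpace φ μ) : Set ℝ :=
  {r | ∃ g : Ω → ℝ, AEStronglyMeasurable g μ ∧ modular (complementary φ.toFun) μ g ≤ 1 ∧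
    r = ∫ t, f.toAEEqFun t * g t ∂μ}

/-- The Orlicz norm. -/
noncomputable instance instNorm : Norm (OrliczSpace φ μ) := ⟨fun f => sSup f.pairings⟩

theorem norm_def (f : OrliczSpace φ μ) : ‖f‖ = sSup f.pairings := rfl

theorem exists_lintegral_le (f : OrliczSpace φ μ) : ∃ C : ℝ≥0, ∀ g : Ω → ℝ,
    modular (complementary φ.toFun) μ g ≤ 1 → ∫⁻ t, ‖f.toAEEqFun t * g t‖ₑ ∂μ ≤ C := by
  obtain ⟨a, ha, hf⟩ := f.2
  change modular φ.toFun μ (fun t => a * f.toAEEqFun t) < ∞ at hf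
  lift a to ℝ≥0 using ha.le
  have ha' : (a : ℝ≥0∞) ≠ 0 := by simpa using (NNReal.coe_pos.1 ha).ne'
  set M := modular φ.toFun μ (fun t => a * f.toAEEqFun t) with hM
  have hfin : (a : ℝ≥0∞)⁻¹ * (M + 1) ≠ ∞ :=
    ENNReal.mul_ne_top (ENNReal.inv_ne_top.2 ha')
      (ENNReal.add_ne_top.2 ⟨hf.ne, ENNReal.one_ne_top⟩)
  refine ⟨((a : ℝ≥0∞)⁻¹ * (M + 1)).toNNReal, fun g hg => ?_⟩
  rw [ENNReal.coe_toNNReal hfin]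
  have hmeas : AEMeasurable (fun t => φ.toFun ‖a * f.toAEEqFun t‖₊) μ :=
    φ.mono.measurable.comp_aemeasurable (by fun_prop)
  have h1 : (a : ℝ≥0∞) * ∫⁻ t, ‖f.toAEEqFun t * g t‖ₑ ∂μ ≤ M + 1 := by
    rw [← lintegral_const_mul' _ _ ENNReal.coe_ne_top]
    calc ∫⁻ t, (a : ℝ≥0∞) * ‖f.toAEEqFun t * g t‖ₑ ∂μ
        ≤ ∫⁻ t, (φ.toFun ‖a * f.toAEEqFun t‖₊ + complementary φ.toFun ‖g t‖₊) ∂μ := by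
          refine lintegral_mono fun t => ?_
          refine le_trans (le_of_eq ?_) (φ.young ‖a * f.toAEEqFun t‖₊ ‖g t‖₊)
          simp [enorm_eq_nnnorm, nnnorm_mul, mul_assoc]
      _ = M + modular (complementary φ.toFun) μ g := lintegral_add_left' hmeas _
      _ ≤ M + 1 := by gcongr
  calc ∫⁻ t, ‖f.toAEEqFun t * g t‖ₑ ∂μ
      = (a : ℝ≥0∞)⁻¹ * (a * ∫⁻ t, ‖f.toAEEqFun t * g t‖ₑ ∂μ) := by
        rw [← mul_assoc, ENNReal.inv_mul_cancel ha' ENNReal.coe_ne_top, one_mul]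
    _ ≤ _ := by gcongr

theorem integrable_mul (f : OrliczSpace φ μ) {g : Ω → ℝ} (hgm : AEStronglyMeasurable g μ)
    (hg : modular (complementary φ.toFun) μ g ≤ 1) :
    Integrable (fun t => f.toAEEqFun t * g t) μ := by
  obtain ⟨C, hC⟩ := f.exists_lintegral_le
  exact ⟨f.toAEEqFun.aestronglyMeasurable.mul hgm, (hC g hg).trans_lt ENNReal.coe_lt_top⟩

theorem pairings_bddAbove (f : OrliczSpace φ μ) : BddAbove f.pairings := by
  obtain ⟨C, hC⟩ := f.exists_lintegral_le
  refine ⟨C, ?_⟩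
  rintro r ⟨g, -, hg, rfl⟩
  refine (le_abs_self _).trans ?_
  rw [← Real.norm_eq_abs, ← coe_nnnorm, NNReal.coe_le_coe, ← ENNReal.coe_le_coe]
  exact (enorm_integral_le_lintegral_enorm _).trans (hC g hg)

theorem modular_zero_le : modular (complementary φ.toFun) μ (fun _ => (0 : ℝ)) ≤ 1 := by
  have : complementary φ.toFun 0 = 0 := by simp [complementary]
  simp [modular, this]

theorem zero_mem_pairings (f : OrliczSpace φ μ) : (0 : ℝ) ∈ f.pairings :=
  ⟨fun _ => 0, aestronglyMeasurable_const, modular_zero_le, by simp⟩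

theorem integral_le_norm (f : OrliczSpace φ μ) {g : Ω → ℝ} (hgm : AEStronglyMeasurable g μ)
    (hg : modular (complementary φ.toFun) μ g ≤ 1) :
    ∫ t, f.toAEEqFun t * g t ∂μ ≤ ‖f‖ :=
  le_csSup f.pairings_bddAbove ⟨g, hgm, hg, rfl⟩

theorem neg_integral_le_norm (f : OrliczSpace φ μ) {g : Ω → ℝ} (hgm : AEStronglyMeasurable g μ)
    (hg : modular (complementary φ.toFun) μ g ≤ 1) :
    -∫ t, f.toAEEqFun t * g t ∂μ ≤ ‖f‖ := by
  have h := f.integral_le_norm (g := fun t => -g t) hgm.neg (by simpa [modular] using hg)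
  simpa [integral_neg] using h

theorem norm_le (f : OrliczSpace φ μ) {C : ℝ} (h : ∀ g : Ω → ℝ, AEStronglyMeasurable g μ →
    modular (complementary φ.toFun) μ g ≤ 1 → ∫ t, f.toAEEqFun t * g t ∂μ ≤ C) : ‖f‖ ≤ C := by
  refine csSup_le ⟨0, f.zero_mem_pairings⟩ ?_
  rintro r ⟨g, hgm, hg, rfl⟩
  exact h g hgm hg

theorem norm_nonneg' (f : OrliczSpace φ μ) : 0 ≤ ‖f‖ :=
  le_csSup f.pairings_bddAbove f.zero_mem_pairings

theorem integral_smul_mul (c : ℝ) (f : OrliczSpace φ μ) (g : Ω → ℝ) :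
    ∫ t, (c • f).toAEEqFun t * g t ∂μ = c * ∫ t, f.toAEEqFun t * g t ∂μ := by
  rw [← integral_const_mul]
  refine integral_congr_ae ?_
  have h : (c • f).toAEEqFun = c • f.toAEEqFun := rfl
  filter_upwards [AEEqFun.coeFn_smul c f.toAEEqFun] with t ht
  rw [h, ht]
  simp [mul_assoc]

theorem norm_smul_le' (c : ℝ) (f : OrliczSpace φ μ) : ‖c • f‖ ≤ |c| * ‖f‖ := by
  refine norm_le _ fun g hgm hg => ?_
  rw [integral_smul_mul]
  have h1 := f.integral_le_norm hgm hg
  have h2 := f.neg_integral_le_norm hgm hg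
  refine (le_abs_self _).trans ?_
  rw [abs_mul]
  gcongr
  exact abs_le.2 ⟨by linarith, h1⟩

theorem norm_smul' (c : ℝ) (f : OrliczSpace φ μ) : ‖c • f‖ = |c| * ‖f‖ := by
  refine le_antisymm (norm_smul_le' c f) ?_
  rcases eq_or_ne c 0 with rfl | hc
  · simpa using norm_nonneg' _
  · have h := norm_smul_le' c⁻¹ (c • f)
    rw [smul_smul, inv_mul_cancel₀ hc, one_smul, abs_inv] at h
    have hc' : 0 < |c| := abs_pos.2 hc
    calc |c| * ‖f‖ ≤ |c| * (|c|⁻¹ * ‖c • f‖) := by gcongr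
      _ = ‖c • f‖ := by field_simp

theorem norm_add_le' (f g : OrliczSpace φ μ) : ‖f + g‖ ≤ ‖f‖ + ‖g‖ := by
  refine norm_le _ fun w hwm hw => ?_
  have h : (f + g).toAEEqFun = f.toAEEqFun + g.toAEEqFun := rfl
  have : ∫ t, (f + g).toAEEqFun t * w t ∂μ
      = ∫ t, f.toAEEqFun t * w t ∂μ + ∫ t, g.toAEEqFun t * w t ∂μ := by
    rw [← integral_add (f.integrable_mul hwm hw) (g.integrable_mul hwm hw)]
    refine integral_congr_ae ?_
    filter_upwards [AEEqFun.coeFn_add f.toAEEqFun g.toAEEqFun] with t ht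
    rw [h, ht]
    simp [add_mul]
  rw [this]
  exact add_le_add (f.integral_le_norm hwm hw) (g.integral_le_norm hwm hw)

theorem eq_zero_of_norm_eq_zero [SigmaFinite μ] (f : OrliczSpace φ μ) (hf : ‖f‖ = 0) : f = 0 := by
  by_contra hne
  have hF : StronglyMeasurable (f.toAEEqFun : Ω → ℝ) := f.toAEEqFun.stronglyMeasurable
  have hS : MeasurableSet {t | f.toAEEqFun t ≠ 0} :=
    (hF.measurable (measurableSet_singleton (0 : ℝ))).compl
  have hpos : 0 < μ {t | f.toAEEqFun t ≠ 0} := by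
    rw [pos_iff_ne_zero]
    intro h0
    apply hne
    apply Subtype.ext
    change f.toAEEqFun = 0
    apply AEEqFun.ext
    have h1 : ∀ᵐ t ∂μ, f.toAEEqFun t = 0 := by rw [ae_iff]; exact h0
    filter_upwards [h1, AEEqFun.coeFn_zero (μ := μ) (β := ℝ)] with t ht ht0
    rw [ht, ht0]; rfl
  obtain ⟨E, hE, hES, hE0, hEtop⟩ := Measure.exists_subset_measure_lt_top hS hpos
  obtain ⟨c, u, hc, hcu⟩ := φ.exists_compl_bound
  obtain ⟨m, hm⟩ : ∃ m : ℝ≥0, (m : ℝ≥0∞) = μ E := ⟨_, ENNReal.coe_toNNReal hEtop.ne⟩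
  set c' : ℝ≥0 := min c (1 / (u * m + 1)) with hc'
  have hc'0 : 0 < c' := lt_min hc (by positivity)
  have hc'1 : c' * (u * m) ≤ 1 := by
    calc c' * (u * m) ≤ 1 / (u * m + 1) * (u * m) := by gcongr; exact min_le_right _ _
      _ = (u * m) / (u * m + 1) := by ring
      _ ≤ 1 := div_le_one_of_le₀ (by simp) zero_le
  let g : Ω → ℝ := E.indicator fun t => (c' : ℝ) * (SignType.sign (f.toAEEqFun t) : ℝ)
  have hgE : ∀ t ∈ E, f.toAEEqFun t * g t = c' * |f.toAEEqFun t| := by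
    intro t ht
    simp only [g, indicator_of_mem ht]
    rw [← self_mul_sign (f.toAEEqFun t)]; ring
  have hgE' : ∀ t, t ∉ E → g t = 0 := fun t ht => indicator_of_notMem ht _
  have hsign : Measurable fun t => (SignType.sign (f.toAEEqFun t) : ℝ) := by
    have h : (fun x : ℝ => (SignType.sign x : ℝ)) =
        fun x => if 0 < x then 1 else if x < 0 then -1 else 0 := by
      funext x
      rw [sign_apply]
      split_ifs <;> simp
    have hm : Measurable fun x : ℝ => (SignType.sign x : ℝ) := by
      rw [h]
      exact Measurable.ite measurableSet_Ioi measurable_const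
        (Measurable.ite measurableSet_Iio measurable_const measurable_const)
    exact hm.comp hF.measurable
  have hgm : AEStronglyMeasurable g μ :=
    ((hsign.const_mul _).indicator hE).aestronglyMeasurable
  have hg : modular (complementary φ.toFun) μ g ≤ 1 := by
    calc modular (complementary φ.toFun) μ g
        ≤ ∫⁻ t, E.indicator (fun _ => (c' : ℝ≥0∞) * u) t ∂μ := by
          refine lintegral_mono fun t => ?_
          by_cases ht : t ∈ E
          · have hn : ‖g t‖₊ = c' := by
              have h0 : f.toAEEqFun t ≠ 0 := hES ht
              simp only [g, indicator_of_mem ht]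
              rcases lt_or_gt_of_ne h0 with h | h
              · simp [sign_neg h]
              · simp [sign_pos h]
            simp only [hn, indicator_of_mem ht]
            exact hcu _ (min_le_left _ _)
          · simp [hgE' t ht, indicator_of_notMem ht, complementary]
      _ = (c' : ℝ≥0∞) * u * m := by rw [lintegral_indicator_const hE, hm]
      _ ≤ 1 := by rw [mul_assoc]; exact_mod_cast hc'1
  have hle := f.integral_le_norm hgm hg
  rw [hf] at hle
  have hnn : 0 ≤ fun t => f.toAEEqFun t * g t := by
    intro t
    by_cases ht : t ∈ E
    · simp only [hgE t ht, Pi.zero_apply]; positivity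
    · simp [hgE' t ht]
  have hlt : 0 < ∫ t, f.toAEEqFun t * g t ∂μ := by
    rw [integral_pos_iff_support_of_nonneg hnn (f.integrable_mul hgm hg)]
    refine hE0.trans_le (measure_mono fun t ht => ?_)
    rw [Function.mem_support, hgE t ht]
    have h0 : f.toAEEqFun t ≠ 0 := hES ht
    have : (0 : ℝ) < c' := hc'0
    positivity
  exact absurd hle (not_le.2 hlt)

theorem normCore [SigmaFinite μ] : NormedSpace.Core ℝ (OrliczSpace φ μ) where
  norm_nonneg := norm_nonneg'
  norm_smul := norm_smul'
  norm_triangle := norm_add_le'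
  norm_eq_zero_iff f := by
    refine ⟨eq_zero_of_norm_eq_zero f, ?_⟩
    rintro rfl
    simpa using norm_smul' (0 : ℝ) (0 : OrliczSpace φ μ)

noncomputable instance instNormedAddCommGroup [SigmaFinite μ] :
    NormedAddCommGroup (OrliczSpace φ μ) :=
  NormedAddCommGroup.ofCore (normCore (φ := φ) (μ := μ))

noncomputable instance instNormedSpace [SigmaFinite μ] : NormedSpace ℝ (OrliczSpace φ μ) :=
  NormedSpace.ofCore (normCore (φ := φ) (μ := μ))

end OrliczSpace

end OrliczSpace

/-- The slice of the closed unit ball given by `f` and `ε` (used with `‖f‖ = 1` and `0 < ε`). -/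
def slice {X : Type*} [NormedAddCommGroup X] [NormedSpace ℝ X] (f : StrongDual ℝ X) (ε : ℝ) :
    Set X :=
  {x | ‖x‖ ≤ 1 ∧ 1 - ε < f x}

/-- Some slice of the closed unit ball has diameter less than two. -/
def HasSliceDiamLtTwo (X : Type*) [NormedAddCommGroup X] [NormedSpace ℝ X] : Prop :=
  ∃ f : StrongDual ℝ X, ‖f‖ = 1 ∧ ∃ ε : ℝ, 0 < ε ∧ Metric.diam (slice f ε) < 2

/-- The local diameter two property. -/
def LocalDiameterTwo (X : Type*) [NormedAddCommGroup X] [NormedSpace ℝ X] : Prop :=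
  ∀ f : StrongDual ℝ X, ‖f‖ = 1 → ∀ ε : ℝ, 0 < ε → Metric.diam (slice f ε) = 2

/-! Write `ψ` for the complementary function of `φ` and `K` for the set of `g` with `∫ ψ(|g|) ≤ 1`,
so that the Orlicz norm is the supremum of the pairings with `K`. Convexity alone puts `(g ± h) / 2`
in `K` for `g, h ∈ K`. Suppose that for one fixed `g` there is `l > 1/2` such that every `h ∈ K` has
`l (g + h)` or `l (g - h)` in `K`. If `x` and `y` lie in the slice given by `g` and `ε`, testing `x`
on `l (g + h)`, or `y` on `l (g - h)`, gives `∫ (x - y) h ≤ 1/l + ε`, which is below `2` for small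
`ε` (`hasSliceDiamLtTwo_of_pairing`).

Such a `g` is `a` times the indicator of a set `A` with `ψ(a) μ(A) = 1` and `a` beyond the interval
on which `ψ` is linear. Jensen's inequality shows that the functional has norm one, attained in the
direction of the indicator of `A`. Since `ψ` is not linear on `[0, m]` for `m ≥ a`, the midpoint
inequalities for `(a ± v) / 2` together lose a constant `γ > 0` independent of `v`, even after a
slight dilation (`ConvexOn.exists_uniform_midpoint_gap`). Integration gains `γ μ(A)`, which pays for
`l > 1/2` (`exists_modular_gap`).

It remains to find `A` and `a`. Finiteness of `φ` makes the interval of linearity bounded, so on a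
non-atomic space a set of small measure forces `a` to be large. On `ℕ` a singleton has measure one,
so `ψ(a) = 1`, and the hypothesis on `d` and `c` places `a` beyond the interval. -/

/-! ### Even convex functions on the line -/

section EvenConvex

variable {Ψ : ℝ → ℝ}

theorem ConvexOn.map_mul_le_of_map_zero (hc : ConvexOn ℝ univ Ψ) (h0 : Ψ 0 = 0) {c : ℝ}
    (hc0 : 0 ≤ c) (hc1 : c ≤ 1) (x : ℝ) : Ψ (c * x) ≤ c * Ψ x := by
  have h := hc.2 (mem_univ x) (mem_univ 0) hc0 (sub_nonneg.2 hc1) (by ring)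
  simpa [h0] using h

theorem ConvexOn.map_midpoint_le (hc : ConvexOn ℝ univ Ψ) (x y : ℝ) :
    Ψ ((x + y) / 2) ≤ (Ψ x + Ψ y) / 2 := by
  have h := hc.2 (mem_univ x) (mem_univ y) (by norm_num : (0 : ℝ) ≤ 1 / 2)
    (by norm_num : (0 : ℝ) ≤ 1 / 2) (by norm_num)
  simp only [smul_eq_mul] at h
  have e : 1 / 2 * x + 1 / 2 * y = (x + y) / 2 := by ring
  rw [e] at h
  linarith

theorem ConvexOn.nonneg_of_even (hc : ConvexOn ℝ univ Ψ) (he : ∀ x, Ψ (-x) = Ψ x) (h0 : Ψ 0 = 0)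
    (x : ℝ) : 0 ≤ Ψ x := by
  have h := hc.map_midpoint_le x (-x)
  rw [he, add_neg_cancel, zero_div, h0] at h
  linarith

theorem ConvexOn.map_le_of_abs_le_mul (hc : ConvexOn ℝ univ Ψ) (he : ∀ x, Ψ (-x) = Ψ x)
    (h0 : Ψ 0 = 0) {c x y : ℝ} (hc1 : c ≤ 1) (h : |x| ≤ c * |y|) :
    Ψ x ≤ c * Ψ y := by
  have habs : ∀ z, Ψ |z| = Ψ z := fun z => by
    rcases abs_choice z with h | h <;> rw [h]
    exact he z
  rcases eq_or_ne y 0 with rfl | hy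
  · have : x = 0 := by simpa using h
    simp [this, h0]
  · have hy' : 0 < |y| := abs_pos.2 hy
    have h1 : |x| / |y| ≤ c := (div_le_iff₀ hy').2 h
    have h2 := hc.map_mul_le_of_map_zero h0 (c := |x| / |y|) (by positivity) (h1.trans hc1) |y|
    rw [div_mul_cancel₀ _ hy'.ne', habs, habs] at h2
    exact h2.trans (mul_le_mul_of_nonneg_right h1 (hc.nonneg_of_even he h0 y))

/-- A convex function vanishing at `0` that satisfies `Ψ (m / 2) = Ψ m / 2` is linear
on `[0, m]`. -/
theorem ConvexOn.eq_mul_of_half_le (hc : ConvexOn ℝ univ Ψ) (h0 : Ψ 0 = 0) {m : ℝ} (hm : 0 < m)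
    (h : Ψ m / 2 ≤ Ψ (m / 2)) {v : ℝ} (hv0 : 0 ≤ v) (hv : v ≤ m) : Ψ v = Ψ m / m * v := by
  have h1 := hc.map_mul_le_of_map_zero h0 (c := v / m) (by positivity)
    (div_le_one_of_le₀ hv hm.le) m
  have h2 := hc.map_mul_le_of_map_zero h0 (c := (m - v) / m)
    (div_nonneg (sub_nonneg.2 hv) hm.le) (div_le_one_of_le₀ (by linarith) hm.le) m
  rw [div_mul_cancel₀ _ hm.ne'] at h1 h2
  -- The chord bounds at `v` and `m - v` add up to `Ψ m`, while the midpoint inequality and `h`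
  -- bound `Ψ v + Ψ (m - v)` below by `Ψ m`. Hence both chord bounds are equalities.
  have h3 := hc.map_midpoint_le v (m - v)
  rw [add_sub_cancel] at h3
  have e : (m - v) / m * Ψ m = Ψ m - Ψ m / m * v := by field_simp
  have e' : v / m * Ψ m = Ψ m / m * v := by ring
  linarith

/-- At `t = 0` the gap is positive for each `v`: the smaller of `|a ± v| / 2` is at most `m / 2`
with `m = max a |v|`, where the half-value inequality is strict. Compactness makes the gap uniform
for bounded `v` and small `t`. For large `|v|` the two terms on the left are absorbed by `(1 + t) *
Ψ v`, which leaves all of `Ψ a` as the gap. -/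
theorem ConvexOn.exists_uniform_midpoint_gap (hc : ConvexOn ℝ univ Ψ) (he : ∀ x, Ψ (-x) = Ψ x)
    (h0 : Ψ 0 = 0) {a : ℝ} (ha : 0 < a) (hm : ∀ m, a ≤ m → Ψ (m / 2) < Ψ m / 2) :
    ∃ t₀ > 0, ∃ γ > 0, ∀ t, 0 ≤ t → t ≤ t₀ → ∀ v,
      Ψ ((1 + t) / 2 * (a + v)) + Ψ ((1 + t) / 2 * (a - v)) + γ ≤ Ψ a + (1 + t) * Ψ v := by
  have hcont : Continuous Ψ := by
    rw [← continuousOn_univ]; exact hc.continuousOn isOpen_univ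
  have hnn := hc.nonneg_of_even he h0
  -- The nonnegative term `t * Ψ v` is dropped from the difference of the two sides.
  let D : ℝ → ℝ → ℝ := fun t v =>
    Ψ a + Ψ v - Ψ ((1 + t) / 2 * (a + v)) - Ψ ((1 + t) / 2 * (a - v))
  have hDc : Continuous fun p : ℝ × ℝ => D p.1 p.2 := by fun_prop
  have hpos_nonneg : ∀ v, 0 ≤ v → 0 < D 0 v := by
    intro v hv
    have h1 := hc.map_midpoint_le a v
    have h2 := hm (max a v) (le_max_left _ _)
    have h3 : Ψ ((a - v) / 2) ≤ 1 * Ψ (max a v / 2) := by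
      refine hc.map_le_of_abs_le_mul he h0 le_rfl ?_
      rw [one_mul, abs_of_nonneg (a := max a v / 2) (by positivity)]
      have := le_max_left a v
      have := le_max_right a v
      exact abs_le.2 ⟨by linarith, by linarith⟩
    have h4 : Ψ (max a v) ≤ Ψ a + Ψ v := by
      have := hnn a
      have := hnn v
      rcases max_choice a v with h | h <;> rw [h] <;> linarith
    have e1 : (1 + 0) / 2 * (a + v) = (a + v) / 2 := by ring
    have e2 : (1 + 0) / 2 * (a - v) = (a - v) / 2 := by ring
    simp only [D, e1, e2]
    linarith
  have hpos : ∀ v, 0 < D 0 v := by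
    intro v
    rcases le_total 0 v with hv | hv
    · exact hpos_nonneg v hv
    · have h := hpos_nonneg (-v) (by linarith)
      simp only [D, he, sub_neg_eq_add, ← sub_eq_add_neg] at h ⊢
      linarith
  obtain ⟨w, -, hw⟩ := (isCompact_Icc (a := -(3 * a)) (b := 3 * a)).exists_isMinOn
    ⟨0, by constructor <;> linarith⟩ (hDc.comp (Continuous.prodMk_right (0 : ℝ))).continuousOn
  -- Half of the minimum of `D 0` persists for all `v` in the compact interval at once.
  have hev : ∀ᶠ t in 𝓝 (0 : ℝ), ∀ v ∈ Icc (-(3 * a)) (3 * a), D 0 w / 2 < D t v := by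
    refine isCompact_Icc.eventually_forall_of_forall_eventually fun v hv => ?_
    have h1 : D 0 w ≤ D 0 v := hw hv
    have h2 : D 0 w / 2 < D 0 v := by linarith [hpos w]
    exact hDc.continuousAt.eventually_const_lt h2
  obtain ⟨r, hr, hball⟩ := Metric.eventually_nhds_iff.1 hev
  have hΨa : 0 < Ψ a := by linarith [hm a le_rfl, hnn (a / 2)]
  refine ⟨min (r / 2) (1 / 2), by positivity, min (D 0 w / 2) (Ψ a),
    lt_min (by linarith [hpos w]) hΨa, fun t ht ht₀ v => ?_⟩
  have hγ1 := min_le_left (D 0 w / 2) (Ψ a)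
  have hγ2 := min_le_right (D 0 w / 2) (Ψ a)
  have htr : t ≤ r / 2 := ht₀.trans (min_le_left _ _)
  have ht1 : t ≤ 1 / 2 := ht₀.trans (min_le_right _ _)
  -- With `t ≤ 1/2`, the threshold `3 * a` gives `(1 + t) / 2 * (1 + a / |v|) ≤ 3/4 * 4/3 = 1`, so
  -- the contraction bound applies to both points.
  by_cases hv : |v| ≤ 3 * a
  · have h := hball (y := t) (by rw [Real.dist_eq, sub_zero, abs_of_nonneg ht]; linarith) v
      (abs_le.1 hv)
    simp only [D] at h hγ1 ⊢
    have := mul_nonneg ht (hnn v)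
    linarith
  · push Not at hv
    have hv0 : 0 < |v| := by linarith
    have hav : a / |v| ≤ 1 / 3 := by rw [div_le_iff₀ hv0]; linarith
    have hav0 : 0 < a / |v| := by positivity
    have hbig : ∀ s : ℝ, |s| ≤ |v| + a →
        Ψ ((1 + t) / 2 * s) ≤ (1 + t) / 2 * (1 + a / |v|) * Ψ v := by
      intro s hs
      refine hc.map_le_of_abs_le_mul he h0 (by nlinarith) ?_
      rw [abs_mul, abs_of_pos (by positivity : 0 < (1 + t) / 2), mul_assoc]
      gcongr
      rw [add_mul, div_mul_cancel₀ _ hv0.ne', one_mul]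
      exact hs
    have hsmall : ∀ s : ℝ, |s| ≤ |v| - a →
        Ψ ((1 + t) / 2 * s) ≤ (1 + t) / 2 * (1 - a / |v|) * Ψ v := by
      intro s hs
      refine hc.map_le_of_abs_le_mul he h0 (by nlinarith) ?_
      rw [abs_mul, abs_of_pos (by positivity : 0 < (1 + t) / 2), mul_assoc]
      gcongr
      rw [sub_mul, div_mul_cancel₀ _ hv0.ne', one_mul]
      exact hs
    -- One of `a ± v` has modulus at most `|v| + a`, the other at most `|v| - a`; the corrections `±
    -- a / |v|` cancel in the sum.
    have key : Ψ ((1 + t) / 2 * (a + v)) + Ψ ((1 + t) / 2 * (a - v)) ≤ (1 + t) * Ψ v := by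
      rcases le_total 0 v with h | h
      · rw [abs_of_nonneg h] at *
        have h1 := hbig (a + v) (abs_le.2 ⟨by linarith, by linarith⟩)
        have h2 := hsmall (a - v) (abs_le.2 ⟨by linarith, by linarith⟩)
        linarith
      · rw [abs_of_nonpos h] at *
        have h1 := hbig (a - v) (abs_le.2 ⟨by linarith, by linarith⟩)
        have h2 := hsmall (a + v) (abs_le.2 ⟨by linarith, by linarith⟩)
        linarith
    linarith

/-- A supporting line of positive slope. -/
theorem ConvexOn.exists_pos_support_line (hc : ConvexOn ℝ univ Ψ) (h0 : Ψ 0 = 0) {a : ℝ}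
    (ha : 0 < a) (hpos : 0 < Ψ a) : ∃ k > 0, ∀ v, Ψ a + k * (v - a) ≤ Ψ v := by
  have key : ∀ v, Ψ a + derivWithin Ψ (Ioi a) a * (v - a) ≤ Ψ v := by
    intro v
    rcases lt_trichotomy v a with h | rfl | h
    · have h1 := (hc.slope_le_leftDeriv_of_mem_interior (mem_univ v) (by simp) h).trans
        (hc.leftDeriv_le_rightDeriv_of_mem_interior (by simp))
      rw [slope_def_field, div_le_iff₀ (sub_pos.2 h)] at h1
      linarith
    · simp
    · have h1 := hc.rightDeriv_le_slope_of_mem_interior (x := a) (by simp) (mem_univ v) h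
      rw [slope_def_field, le_div_iff₀ (sub_pos.2 h)] at h1
      linarith
  refine ⟨_, ?_, key⟩
  -- The line lies below `Ψ 0 = 0` at the origin and equals `Ψ a > 0` at `a`, so its slope is
  -- positive.
  have h := key 0
  rw [h0, zero_sub] at h
  exact pos_of_mul_pos_left (by linarith : 0 < derivWithin Ψ (Ioi a) a * a) ha.le

end EvenConvex

/-! ### Finiteness, convexity and linearity interval of the complementary function -/

namespace OrliczFunction

variable (φ : OrliczFunction)

theorem complementary_zero : complementary φ.toFun 0 = 0 := by simp [complementary]

theorem complementary_mono : Monotone (complementary φ.toFun) := by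
  intro u v huv
  refine iSup_mono fun w => ?_
  gcongr

theorem complementary_convex {s t : ℝ≥0} (hst : s + t = 1) (u v : ℝ≥0) :
    complementary φ.toFun (s * u + t * v) ≤
      s * complementary φ.toFun u + t * complementary φ.toFun v := by
  refine iSup_le fun w => tsub_le_iff_left.2 ?_
  have hst' : (s : ℝ≥0∞) + t = 1 := by exact_mod_cast hst
  calc ((s * u + t * v : ℝ≥0) : ℝ≥0∞) * w = s * (w * u) + t * (w * v) := by push_cast; ring
    _ ≤ s * (φ.toFun w + complementary φ.toFun u) + t * (φ.toFun w + complementary φ.toFun v) := by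
      gcongr <;> exact φ.young _ _
    _ = (s + t) * φ.toFun w +
        (s * complementary φ.toFun u + t * complementary φ.toFun v) := by ring
    _ = _ := by rw [hst', one_mul]

variable {φ}

/-- Superlinearity gives `φ v ≥ u v` for large `v`, so only a bounded range of `v` contributes to
the supremum. Hence `toReal` in `complementaryReal` loses nothing. -/
theorem IsNFunctionAtInfty.complementary_ne_top (hN : φ.IsNFunctionAtInfty) (u : ℝ≥0) :
    complementary φ.toFun u ≠ ∞ := by
  have h1 : ∀ᶠ v : ℝ≥0 in atTop, (u : ℝ≥0∞) < φ.toFun v / v :=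
    hN.eventually_const_lt ENNReal.coe_lt_top
  obtain ⟨V, hV⟩ := eventually_atTop.1 h1
  refine ne_top_of_le_ne_top (b := (u : ℝ≥0∞) * V) (by finiteness) (iSup_le fun v => ?_)
  rcases le_total v V with h | h
  · exact tsub_le_self.trans (by gcongr)
  · rw [tsub_eq_zero_of_le (ENNReal.mul_le_of_le_div (hV v h).le)]
    exact zero_le

/-- The complementary function as a real even function on the line. -/
noncomputable def complementaryReal (φ : OrliczFunction) (x : ℝ) : ℝ :=
  (complementary φ.toFun ‖x‖₊).toReal

theorem complementaryReal_neg (x : ℝ) : φ.complementaryReal (-x) = φ.complementaryReal x := by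
  simp [complementaryReal]

theorem complementaryReal_zero : φ.complementaryReal 0 = 0 := by
  simp [complementaryReal, φ.complementary_zero]

theorem complementaryReal_nonneg (x : ℝ) : 0 ≤ φ.complementaryReal x := ENNReal.toReal_nonneg

theorem IsNFunctionAtInfty.ofReal_complementaryReal (hN : φ.IsNFunctionAtInfty) (x : ℝ) :
    ENNReal.ofReal (φ.complementaryReal x) = complementary φ.toFun ‖x‖₊ :=
  ENNReal.ofReal_toReal (hN.complementary_ne_top _)

theorem IsNFunctionAtInfty.convexOn_complementaryReal (hN : φ.IsNFunctionAtInfty) :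
    ConvexOn ℝ univ φ.complementaryReal := by
  refine ⟨convex_univ, fun x _ y _ s t hs ht hst => ?_⟩
  lift s to ℝ≥0 using hs
  lift t to ℝ≥0 using ht
  have hst' : s + t = 1 := by exact_mod_cast hst
  have h1 : ‖(s : ℝ) • x + (t : ℝ) • y‖₊ ≤ s * ‖x‖₊ + t * ‖y‖₊ := by
    refine (nnnorm_add_le _ _).trans ?_
    simp [nnnorm_mul]
  have h2 := (φ.complementary_mono h1).trans (φ.complementary_convex hst' ‖x‖₊ ‖y‖₊)
  have hx := hN.complementary_ne_top ‖x‖₊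
  have hy := hN.complementary_ne_top ‖y‖₊
  have h3 := ENNReal.toReal_mono (by finiteness) h2
  rw [ENNReal.toReal_add (by finiteness) (by finiteness)] at h3
  simpa [complementaryReal] using h3

theorem IsNFunctionAtInfty.continuous_complementaryReal (hN : φ.IsNFunctionAtInfty) :
    Continuous φ.complementaryReal := by
  rw [← continuousOn_univ]
  exact hN.convexOn_complementaryReal.continuousOn isOpen_univ

theorem IsNFunctionAtInfty.half_lt_of_linearityBound_lt (hN : φ.IsNFunctionAtInfty) {m : ℝ≥0}
    (hm : linearityBound (complementary φ.toFun) < m) :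
    φ.complementaryReal (m / 2) < φ.complementaryReal m / 2 := by
  by_contra! h
  have hm0 : 0 < m := by exact_mod_cast (zero_le.trans_lt hm)
  have hk : 0 ≤ φ.complementaryReal m / m := by
    have := φ.complementaryReal_nonneg m; positivity
  refine hm.not_ge (le_iSup₂_of_le m
    ⟨(φ.complementaryReal m / m).toNNReal, fun v hv => ?_⟩ le_rfl)
  have hlin := hN.convexOn_complementaryReal.eq_mul_of_half_le complementaryReal_zero
    (NNReal.coe_pos.2 hm0) h v.coe_nonneg (NNReal.coe_le_coe.2 hv)
  have h1 := hN.ofReal_complementaryReal v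
  rw [NNReal.nnnorm_eq] at h1
  rw [← h1, hlin, ENNReal.ofReal_mul hk, ENNReal.ofReal_coe_nnreal, ENNReal.ofReal]

/-- Young's inequality at `1` gives the lower bound `x - φ 1`, and `φ 1` is finite. -/
theorem IsFinite.tendsto_complementaryReal (hfin : φ.IsFinite) (hN : φ.IsNFunctionAtInfty) :
    Tendsto φ.complementaryReal atTop atTop := by
  have h : ∀ x : ℝ, 0 ≤ x → x - (φ.toFun 1).toReal ≤ φ.complementaryReal x := by
    intro x hx
    lift x to ℝ≥0 using hx
    have h1 := φ.young 1 x
    have hx' := hN.complementary_ne_top x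
    have h2 := ENNReal.toReal_mono (by finiteness [hfin 1]) h1
    rw [ENNReal.toReal_add (hfin 1) hx'] at h2
    simp only [ENNReal.coe_one, one_mul, ENNReal.coe_toReal] at h2
    simp only [complementaryReal, NNReal.nnnorm_eq]
    linarith
  refine tendsto_atTop_mono' atTop (eventually_atTop.2 ⟨0, h⟩) ?_
  exact tendsto_atTop_add_const_right _ _ tendsto_id

theorem IsFinite.exists_complementary_eq (hfin : φ.IsFinite) (hN : φ.IsNFunctionAtInfty) {r : ℝ}
    (hr : 0 ≤ r) : ∃ a : ℝ≥0, φ.complementaryReal a = r := by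
  obtain ⟨b, hb0, hb⟩ := ((eventually_ge_atTop (0 : ℝ)).and
    ((hfin.tendsto_complementaryReal hN).eventually_ge_atTop r)).exists
  obtain ⟨a, ha, hae⟩ := intermediate_value_Icc hb0
    hN.continuous_complementaryReal.continuousOn
    (show r ∈ Icc _ _ from ⟨complementaryReal_zero.trans_le hr, hb⟩)
  exact ⟨⟨a, ha.1⟩, hae⟩

/-- Linearity on `[0, u]` with `u ≥ 1` forces the slope `k₁ = ψ(1)`. Young's inequality at `k₁ + 1`
then reads `(k₁ + 1) u ≤ φ (k₁ + 1) + k₁ u`, so `u ≤ φ (k₁ + 1)`. -/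
theorem IsFinite.linearityBound_ne_top (hfin : φ.IsFinite) (hN : φ.IsNFunctionAtInfty) :
    linearityBound (complementary φ.toFun) ≠ ∞ := by
  set k₁ := (complementary φ.toFun 1).toNNReal
  have hk₁ : (k₁ : ℝ≥0∞) = complementary φ.toFun 1 :=
    ENNReal.coe_toNNReal (hN.complementary_ne_top 1)
  refine ne_top_of_le_ne_top (b := max 1 (φ.toFun (k₁ + 1))) (by finiteness [hfin (k₁ + 1)])
    (iSup₂_le fun u hu => ?_)
  rcases le_total u 1 with h | h
  · exact le_max_of_le_left (by exact_mod_cast h)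
  · obtain ⟨k, hk⟩ := hu
    have hkk : k = k₁ := by
      have := hk 1 h
      rw [← hk₁] at this
      simpa using this.symm
    have h1 := φ.young (k₁ + 1) u
    rw [hk u le_rfl, hkk] at h1
    push_cast at h1
    rw [add_mul, one_mul, add_comm] at h1
    exact le_max_of_le_right ((ENNReal.add_le_add_iff_right (by finiteness)).1 h1)

end OrliczFunction

/-! ### Integral functionals and the slice criterion -/

namespace OrliczSpace

variable {Ω : Type*} [MeasurableSpace Ω] {φ : OrliczFunction} {μ : Measure Ω}

theorem integral_add_mul (x y : OrliczSpace φ μ) {g : Ω → ℝ} (hgm : AEStronglyMeasurable g μ)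
    (hg : modular (complementary φ.toFun) μ g ≤ 1) :
    ∫ t, (x + y).toAEEqFun t * g t ∂μ
      = ∫ t, x.toAEEqFun t * g t ∂μ + ∫ t, y.toAEEqFun t * g t ∂μ := by
  rw [← integral_add (x.integrable_mul hgm hg) (y.integrable_mul hgm hg)]
  have h : (x + y).toAEEqFun = x.toAEEqFun + y.toAEEqFun := rfl
  refine integral_congr_ae ?_
  filter_upwards [AEEqFun.coeFn_add x.toAEEqFun y.toAEEqFun] with t ht
  rw [h, ht]
  simp [add_mul]

theorem integral_sub_mul (x y : OrliczSpace φ μ) {g : Ω → ℝ} (hgm : AEStronglyMeasurable g μ)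
    (hg : modular (complementary φ.toFun) μ g ≤ 1) :
    ∫ t, (x - y).toAEEqFun t * g t ∂μ
      = ∫ t, x.toAEEqFun t * g t ∂μ - ∫ t, y.toAEEqFun t * g t ∂μ := by
  have h := integral_smul_mul (-1) y g
  rw [sub_eq_add_neg, ← neg_one_smul ℝ y, integral_add_mul _ _ hgm hg, h]
  ring

/-- The functional `x ↦ ∫ x g dμ` for `g` in the unit ball of the complementary modular. -/
noncomputable def pairing [SigmaFinite μ] (g : Ω → ℝ) (hgm : AEStronglyMeasurable g μ)
    (hg : modular (complementary φ.toFun) μ g ≤ 1) : StrongDual ℝ (OrliczSpace φ μ) :=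
  LinearMap.mkContinuous
    { toFun := fun x => ∫ t, x.toAEEqFun t * g t ∂μ
      map_add' := fun x y => integral_add_mul x y hgm hg
      map_smul' := fun c x => integral_smul_mul c x g } 1 (fun x => by
        rw [one_mul]
        refine abs_le.2 ⟨?_, x.integral_le_norm hgm hg⟩
        have := x.neg_integral_le_norm hgm hg
        change -‖x‖ ≤ ∫ t, x.toAEEqFun t * g t ∂μ
        linarith)

theorem pairing_apply [SigmaFinite μ] {g : Ω → ℝ} (hgm : AEStronglyMeasurable g μ)
    (hg : modular (complementary φ.toFun) μ g ≤ 1) (x : OrliczSpace φ μ) :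
    pairing g hgm hg x = ∫ t, x.toAEEqFun t * g t ∂μ := rfl

theorem norm_pairing_le [SigmaFinite μ] {g : Ω → ℝ} (hgm : AEStronglyMeasurable g μ)
    (hg : modular (complementary φ.toFun) μ g ≤ 1) :
    ‖(pairing g hgm hg : StrongDual ℝ (OrliczSpace φ μ))‖ ≤ 1 :=
  LinearMap.mkContinuous_norm_le _ zero_le_one _

/-- If a norm-one functional is given by `g` and, for every `h` in the unit ball of the
complementary modular, one of `l (g + h)`, `l (g - h)` stays in that ball, where `l > 1 / 2` is
fixed, then the functional has a slice of diameter less than two. -/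
theorem hasSliceDiamLtTwo_of_pairing [SigmaFinite μ] {g : Ω → ℝ}
    (hgm : AEStronglyMeasurable g μ) (hg : modular (complementary φ.toFun) μ g ≤ 1)
    (hnorm : ‖(pairing g hgm hg : StrongDual ℝ (OrliczSpace φ μ))‖ = 1) {l : ℝ} (hl : 1 / 2 < l)
    (h : ∀ h : Ω → ℝ, AEStronglyMeasurable h μ → modular (complementary φ.toFun) μ h ≤ 1 →
      modular (complementary φ.toFun) μ (fun t => l * (g t + h t)) ≤ 1 ∨
      modular (complementary φ.toFun) μ (fun t => l * (g t - h t)) ≤ 1) :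
    HasSliceDiamLtTwo (OrliczSpace φ μ) := by
  have hl0 : 0 < l := by linarith
  have hl2 : 1 / l < 2 := by rw [div_lt_iff₀ hl0]; linarith
  -- This `ε` makes `1 / l + ε` the midpoint of `1 / l` and `2`.
  refine ⟨pairing g hgm hg, hnorm, (2 - 1 / l) / 2, by linarith, ?_⟩
  have hC : 0 ≤ 1 / l + (2 - 1 / l) / 2 := by
    have : 0 < 1 / l := by positivity
    linarith
  refine lt_of_le_of_lt (Metric.diam_le_of_forall_dist_le hC ?_)
    (by linarith : 1 / l + (2 - 1 / l) / 2 < 2)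
  rintro x ⟨hx, hxg⟩ y ⟨hy, hyg⟩
  rw [dist_eq_norm]
  rw [pairing_apply] at hxg hyg
  refine norm_le _ fun w hwm hw => ?_
  rw [integral_sub_mul _ _ hwm hw]
  have hxw := (x.integral_le_norm hwm hw).trans hx
  have hyw := (y.neg_integral_le_norm hwm hw).trans hy
  have hexp : ∀ (z : OrliczSpace φ μ) (c : ℝ), ∫ t, z.toAEEqFun t * (l * (g t + c * w t)) ∂μ =
      l * (∫ t, z.toAEEqFun t * g t ∂μ + c * ∫ t, z.toAEEqFun t * w t ∂μ) := by
    intro z c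
    rw [← integral_const_mul c, ← integral_add (z.integrable_mul hgm hg)
      ((z.integrable_mul hwm hw).const_mul c), ← integral_const_mul]
    congr 1 with t
    ring
  -- If `l (g + w)` is admissible, then `∫ x w ≤ 1 / l - ∫ x g < 1 / l - 1 + ε`, while `-∫ y w ≤ 1`.
  -- In the other case `x` and `y` exchange roles.
  rcases h w hwm hw with hp | hm
  · have h1 := (x.integral_le_norm ((hgm.add hwm).const_mul l) hp).trans hx
    have h2 := hexp x 1
    simp only [one_mul] at h2
    simp only [Pi.add_apply] at h1
    rw [h2, ← le_div_iff₀' hl0] at h1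
    linarith
  · have h1 := (y.integral_le_norm ((hgm.sub hwm).const_mul l) hm).trans hy
    have h2 := hexp y (-1)
    simp only [neg_one_mul, ← sub_eq_add_neg] at h2
    simp only [Pi.sub_apply] at h1
    rw [h2, ← le_div_iff₀' hl0] at h1
    linarith

/-! ### Functionals given by multiples of indicators -/

theorem memOrlicz_indicator (hfin : φ.IsFinite) {A : Set Ω} (hA : MeasurableSet A)
    (hAtop : μ A ≠ ∞) :
    AEEqFun.mk (A.indicator fun _ => (1 : ℝ)) (aestronglyMeasurable_const.indicator hA) ∈
      orliczSubmodule φ μ := by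
  refine ⟨1, one_pos, ?_⟩
  calc modular φ.toFun μ (fun t => 1 * AEEqFun.mk (A.indicator fun _ => (1 : ℝ))
          (aestronglyMeasurable_const.indicator hA) t)
      = ∫⁻ t, A.indicator (fun _ => φ.toFun 1) t ∂μ := by
        refine lintegral_congr_ae ?_
        filter_upwards [AEEqFun.coeFn_mk (A.indicator fun _ => (1 : ℝ))
          (aestronglyMeasurable_const.indicator hA)] with t ht
        rw [ht]
        by_cases h : t ∈ A <;> simp [h, φ.map_zero]
    _ = φ.toFun 1 * μ A := lintegral_indicator_const hA _
    _ < ∞ := ENNReal.mul_lt_top (hfin 1).lt_top hAtop.lt_top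

/-- The class of the indicator function of a set of finite measure. -/
noncomputable def indicatorOne (hfin : φ.IsFinite) {A : Set Ω} (hA : MeasurableSet A)
    (hAtop : μ A ≠ ∞) : OrliczSpace φ μ :=
  ⟨_, memOrlicz_indicator hfin hA hAtop⟩

theorem integral_indicatorOne_mul (hfin : φ.IsFinite) {A : Set Ω} (hA : MeasurableSet A)
    (hAtop : μ A ≠ ∞) (g : Ω → ℝ) :
    ∫ t, (indicatorOne (φ := φ) hfin hA hAtop).toAEEqFun t * g t ∂μ = ∫ t in A, g t ∂μ := by
  rw [← integral_indicator hA]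
  refine integral_congr_ae ?_
  filter_upwards [AEEqFun.coeFn_mk (A.indicator fun _ => (1 : ℝ))
    (aestronglyMeasurable_const.indicator hA)] with t ht
  change (AEEqFun.mk (A.indicator fun _ => (1 : ℝ))
    (aestronglyMeasurable_const.indicator hA) : Ω →ₘ[μ] ℝ) t * g t = _
  rw [ht]
  by_cases h : t ∈ A <;> simp [h]

theorem modular_indicator_const {ψ : ℝ≥0 → ℝ≥0∞} (hψ : ψ 0 = 0) {A : Set Ω}
    (hA : MeasurableSet A) (a : ℝ) :
    modular ψ μ (A.indicator fun _ => a) = ψ ‖a‖₊ * μ A := by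
  rw [← lintegral_indicator_const hA]
  refine lintegral_congr fun t => ?_
  by_cases h : t ∈ A <;> simp [h, hψ]

/-- Jensen's inequality for the mean of `h` over `A`, by a supporting line at `a`. -/
theorem setIntegral_le_of_modular_le_one (hN : φ.IsNFunctionAtInfty) {A : Set Ω}
    (hAtop : μ A ≠ ∞) {a : ℝ} (ha : 0 < a)
    (haA : φ.complementaryReal a * μ.real A = 1) {h : Ω → ℝ} (hint : IntegrableOn h A μ)
    (hh : modular (complementary φ.toFun) μ h ≤ 1) : ∫ t in A, h t ∂μ ≤ a * μ.real A := by
  have hpos : 0 < φ.complementaryReal a :=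
    (φ.complementaryReal_nonneg a).lt_of_ne fun h0 => by simp [← h0] at haA
  obtain ⟨k, hk, hline⟩ := hN.convexOn_complementaryReal.exists_pos_support_line
    OrliczFunction.complementaryReal_zero ha hpos
  have hlin : ∫⁻ t, ENNReal.ofReal (φ.complementaryReal (h t)) ∂μ ≤ 1 := by
    simpa only [hN.ofReal_complementaryReal, modular] using hh
  have hlinA := (setLIntegral_le_lintegral A
    fun t => ENNReal.ofReal (φ.complementaryReal (h t))).trans hlin
  have hmeas : AEStronglyMeasurable (fun t => φ.complementaryReal (h t)) (μ.restrict A) :=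
    hN.continuous_complementaryReal.comp_aestronglyMeasurable hint.1
  have hintc : IntegrableOn (fun t => φ.complementaryReal (h t)) A μ :=
    ⟨hmeas, (hasFiniteIntegral_iff_ofReal
      (ae_of_all _ fun t => φ.complementaryReal_nonneg _)).2 (hlinA.trans_lt ENNReal.one_lt_top)⟩
  have h1 : ∫ t in A, φ.complementaryReal (h t) ∂μ ≤ 1 := by
    rw [integral_eq_lintegral_of_nonneg_ae (ae_of_all _ fun t => φ.complementaryReal_nonneg _)
      hmeas]
    exact ENNReal.toReal_le_of_le_ofReal zero_le_one (by simpa using hlinA)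
  have hconst : ∀ c : ℝ, IntegrableOn (fun _ => c) A μ := fun c => integrableOn_const hAtop
  -- The integrated supporting line is at most `1 = ψ(a) μ(A)`. Cancelling this and the slope `k >
  -- 0` leaves the bound on the mean.
  have h2 : ∫ t in A, (φ.complementaryReal a + k * (h t - a)) ∂μ ≤
      ∫ t in A, φ.complementaryReal (h t) ∂μ :=
    integral_mono ((hconst _).add ((hint.sub (hconst a)).const_mul k)) hintc fun t => hline _
  have hsub : IntegrableOn (fun t => h t - a) A μ := hint.sub (hconst a)
  rw [integral_add (hconst _) (hsub.const_mul k), integral_const_mul,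
    integral_sub hint (hconst a), setIntegral_const, setIntegral_const, smul_eq_mul, smul_eq_mul,
    mul_comm, haA] at h2
  have h3 : k * (∫ t in A, h t ∂μ - μ.real A * a) ≤ k * 0 := by linarith
  have h4 := le_of_mul_le_mul_left h3 hk
  linarith

/-- The indicator of `A` has norm at most `a * μ.real A` by Jensen's inequality, and the functional
takes exactly this value on it. -/
theorem norm_pairing_indicator_const [SigmaFinite μ] (hfin : φ.IsFinite)
    (hN : φ.IsNFunctionAtInfty) {A : Set Ω} (hA : MeasurableSet A) (hAtop : μ A ≠ ∞) {a : ℝ}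
    (ha : 0 < a) (haA : φ.complementaryReal a * μ.real A = 1)
    (hgm : AEStronglyMeasurable (A.indicator fun _ => a) μ)
    (hg : modular (complementary φ.toFun) μ (A.indicator fun _ => a) ≤ 1) :
    ‖(pairing _ hgm hg : StrongDual ℝ (OrliczSpace φ μ))‖ = 1 := by
  refine le_antisymm (norm_pairing_le hgm hg) ?_
  have hA0 : 0 < μ.real A := measureReal_nonneg.lt_of_ne fun h0 => by simp [← h0] at haA
  set e : OrliczSpace φ μ := indicatorOne hfin hA hAtop
  have he : ‖e‖ ≤ a * μ.real A := by
    refine norm_le _ fun w hwm hw => ?_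
    have hint := e.integrable_mul hwm hw
    rw [integral_indicatorOne_mul]
    refine setIntegral_le_of_modular_le_one hN hAtop ha haA ?_ hw
    rw [← integrable_indicator_iff hA]
    refine hint.congr ?_
    filter_upwards [AEEqFun.coeFn_mk (A.indicator fun _ => (1 : ℝ))
      (aestronglyMeasurable_const.indicator hA)] with t ht
    change (AEEqFun.mk (A.indicator fun _ => (1 : ℝ))
      (aestronglyMeasurable_const.indicator hA) : Ω →ₘ[μ] ℝ) t * w t = _
    rw [ht]
    by_cases h : t ∈ A <;> simp [h]
  have hval : pairing _ hgm hg e = a * μ.real A := by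
    rw [pairing_apply, integral_indicatorOne_mul, setIntegral_indicator hA, inter_self,
      setIntegral_const, smul_eq_mul, mul_comm]
  have hle := (pairing _ hgm hg : StrongDual ℝ (OrliczSpace φ μ)).le_opNorm e
  rw [hval, Real.norm_of_nonneg (by positivity)] at hle
  have h1 := hle.trans (mul_le_mul_of_nonneg_left he (norm_nonneg _))
  exact (le_mul_iff_one_le_left (by positivity)).1 h1

/-- Integrating the uniform midpoint gap bounds the sum of the two modulars by `2`, so they cannot
both exceed `1`. -/
theorem exists_modular_gap (hN : φ.IsNFunctionAtInfty) {A : Set Ω} (hA : MeasurableSet A)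
    (hAtop : μ A ≠ ∞) {a : ℝ≥0} (hlin : linearityBound (complementary φ.toFun) < a)
    (haA : φ.complementaryReal a * μ.real A = 1) :
    ∃ l : ℝ, 1 / 2 < l ∧ ∀ h : Ω → ℝ, AEStronglyMeasurable h μ →
      modular (complementary φ.toFun) μ h ≤ 1 →
      modular (complementary φ.toFun) μ
        (fun t => l * (A.indicator (fun _ => (a : ℝ)) t + h t)) ≤ 1 ∨
      modular (complementary φ.toFun) μ
        (fun t => l * (A.indicator (fun _ => (a : ℝ)) t - h t)) ≤ 1 := by
  have ha : (0 : ℝ) < a := by exact_mod_cast (zero_le.trans_lt hlin)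
  have hc := hN.convexOn_complementaryReal
  have hA0 : 0 < μ.real A := measureReal_nonneg.lt_of_ne fun h0 => by simp [← h0] at haA
  obtain ⟨t₀, ht₀, γ, hγ, hgap⟩ := hc.exists_uniform_midpoint_gap
    OrliczFunction.complementaryReal_neg OrliczFunction.complementaryReal_zero ha (fun m hm => by
      lift m to ℝ≥0 using ha.le.trans hm
      exact hN.half_lt_of_linearityBound_lt (hlin.trans_le (by exact_mod_cast hm)))
  -- The dilation costs at most `s` in the integrated inequality; `s ≤ γ * μ.real A` lets the gap on
  -- `A` cover it.
  set s := min (min t₀ 1) (γ * μ.real A)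
  have hs0 : 0 < s := by positivity
  have hs1 : s ≤ 1 := (min_le_left _ _).trans (min_le_right _ _)
  refine ⟨(1 + s) / 2, by linarith, fun h hm hh => ?_⟩
  by_contra! hcon
  obtain ⟨hp, hq⟩ := hcon
  set g : Ω → ℝ := A.indicator fun _ => (a : ℝ) with hgdef
  have hgm : AEStronglyMeasurable g μ := aestronglyMeasurable_const.indicator hA
  set C := φ.complementaryReal
  have hCnn : ∀ x, 0 ≤ C x := φ.complementaryReal_nonneg
  have hCm := hN.continuous_complementaryReal
  have hmod : ∀ f : Ω → ℝ,
      modular (complementary φ.toFun) μ f = ∫⁻ t, ENNReal.ofReal (C (f t)) ∂μ :=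
    fun f => lintegral_congr fun t => (hN.ofReal_complementaryReal _).symm
  rw [hmod] at hp hq hh
  have hpt : ∀ t, C ((1 + s) / 2 * (g t + h t)) + C ((1 + s) / 2 * (g t - h t)) +
      A.indicator (fun _ => γ) t ≤ A.indicator (fun _ => C a) t + (1 + s) * C (h t) := by
    intro t
    by_cases ht : t ∈ A
    · simp only [hgdef, indicator_of_mem ht]
      exact hgap s hs0.le ((min_le_left _ _).trans (min_le_left _ _)) (h t)
    -- Off `A` there is no gap: each term is at most `(1 + s) / 2 * C (h t)` because `(1 + s) / 2 ≤
    -- 1`.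
    · simp only [hgdef, indicator_of_notMem ht, zero_add, add_zero, zero_sub, mul_neg]
      rw [show C (-((1 + s) / 2 * h t)) = _ from OrliczFunction.complementaryReal_neg _]
      have := hc.map_mul_le_of_map_zero OrliczFunction.complementaryReal_zero
        (c := (1 + s) / 2) (by positivity) (by linarith) (h t)
      linarith
  have hind : ∀ c : ℝ, 0 ≤ c → ∫⁻ t, ENNReal.ofReal (A.indicator (fun _ => c) t) ∂μ =
      ENNReal.ofReal (c * μ.real A) := by
    intro c hc0
    rw [ENNReal.ofReal_mul hc0, ofReal_measureReal hAtop, ← lintegral_indicator_const hA]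
    refine lintegral_congr fun t => ?_
    by_cases ht : t ∈ A <;> simp [ht]
  have hm1 : AEMeasurable (fun t => ENNReal.ofReal (C ((1 + s) / 2 * (g t + h t)))) μ :=
    (hCm.comp_aestronglyMeasurable ((hgm.add hm).const_mul _)).aemeasurable.ennreal_ofReal
  have hm2 : AEMeasurable (fun t => ENNReal.ofReal (C ((1 + s) / 2 * (g t - h t)))) μ :=
    (hCm.comp_aestronglyMeasurable ((hgm.sub hm).const_mul _)).aemeasurable.ennreal_ofReal
  have hm3 : ∀ c : ℝ, AEMeasurable (fun t => ENNReal.ofReal (A.indicator (fun _ => c) t)) μ :=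
    fun c => (measurable_const.indicator hA).ennreal_ofReal.aemeasurable
  have hsum := lintegral_mono (μ := μ) fun t => ENNReal.ofReal_le_ofReal (hpt t)
  have hγi : ∀ t, 0 ≤ A.indicator (fun _ => γ) t := fun t =>
    indicator_nonneg (fun _ _ => hγ.le) t
  have hai : ∀ t, 0 ≤ A.indicator (fun _ => C a) t := fun t =>
    indicator_nonneg (fun _ _ => hCnn _) t
  have e1 : ∀ t, ENNReal.ofReal (C ((1 + s) / 2 * (g t + h t)) + C ((1 + s) / 2 * (g t - h t)) +
      A.indicator (fun _ => γ) t) = ENNReal.ofReal (C ((1 + s) / 2 * (g t + h t))) +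
      ENNReal.ofReal (C ((1 + s) / 2 * (g t - h t))) + ENNReal.ofReal (A.indicator (fun _ => γ) t) :=
    fun t => by rw [ENNReal.ofReal_add (add_nonneg (hCnn _) (hCnn _)) (hγi t),
      ENNReal.ofReal_add (hCnn _) (hCnn _)]
  have e2 : ∀ t, ENNReal.ofReal (A.indicator (fun _ => C a) t + (1 + s) * C (h t)) =
      ENNReal.ofReal (A.indicator (fun _ => C a) t) +
      ENNReal.ofReal (1 + s) * ENNReal.ofReal (C (h t)) :=
    fun t => by rw [ENNReal.ofReal_add (hai t) (mul_nonneg (by linarith) (hCnn _)),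
      ENNReal.ofReal_mul (by linarith)]
  simp only [e1, e2] at hsum
  rw [lintegral_add_right' _ (hm3 γ), lintegral_add_left' hm1, lintegral_add_left' (hm3 _),
    lintegral_const_mul' _ _ ENNReal.ofReal_ne_top, hind γ hγ.le, hind _ (hCnn _), haA] at hsum
  have hupper : ENNReal.ofReal 1 + ENNReal.ofReal (1 + s) * ∫⁻ t, ENNReal.ofReal (C (h t)) ∂μ ≤
      2 + ENNReal.ofReal (γ * μ.real A) := by
    calc _ ≤ ENNReal.ofReal 1 + ENNReal.ofReal (1 + s) * 1 := by gcongr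
      _ = ENNReal.ofReal (2 + s) := by
        rw [mul_one, ← ENNReal.ofReal_add zero_le_one (by linarith)]; congr 1; ring
      _ ≤ ENNReal.ofReal (2 + γ * μ.real A) :=
        ENNReal.ofReal_le_ofReal (by linarith [min_le_right (min t₀ 1) (γ * μ.real A)])
      _ = _ := by rw [ENNReal.ofReal_add zero_le_two (by positivity)]; simp
  have h2 := (ENNReal.add_le_add_iff_right ENNReal.ofReal_ne_top).1 (hsum.trans hupper)
  have h3 := ENNReal.add_lt_add hp hq
  rw [one_add_one_eq_two] at h3
  exact absurd h3 (not_lt.2 h2)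

/-- If `ψ a * μ A = 1` for the complementary function `ψ` and some `a` beyond its interval of
linearity at `0`, then the functional given by `a` times the indicator of `A` has a slice of
diameter less than two. -/
theorem hasSliceDiamLtTwo_of_indicator [SigmaFinite μ] (hfin : φ.IsFinite)
    (hN : φ.IsNFunctionAtInfty) {A : Set Ω} (hA : MeasurableSet A) (hAtop : μ A ≠ ∞) {a : ℝ≥0}
    (hlin : linearityBound (complementary φ.toFun) < a)
    (haA : φ.complementaryReal a * μ.real A = 1) : HasSliceDiamLtTwo (OrliczSpace φ μ) := by
  have ha : (0 : ℝ) < a := by exact_mod_cast (zero_le.trans_lt hlin)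
  have hgm : AEStronglyMeasurable (A.indicator fun _ => (a : ℝ)) μ :=
    aestronglyMeasurable_const.indicator hA
  have hg : modular (complementary φ.toFun) μ (A.indicator fun _ => (a : ℝ)) ≤ 1 := by
    rw [modular_indicator_const φ.complementary_zero hA, ← hN.ofReal_complementaryReal,
      ← ofReal_measureReal hAtop, ← ENNReal.ofReal_mul (φ.complementaryReal_nonneg _), haA,
      ENNReal.ofReal_one]
  obtain ⟨l, hl, h⟩ := exists_modular_gap hN hA hAtop hlin haA
  exact hasSliceDiamLtTwo_of_pairing hgm hg
    (norm_pairing_indicator_const hfin hN hA hAtop ha haA hgm hg) hl h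

end OrliczSpace

/-! ### Choice of the set and the constant in the two cases -/

theorem HasSliceDiamLtTwo.not_localDiameterTwo {X : Type*} [NormedAddCommGroup X]
    [NormedSpace ℝ X] (h : HasSliceDiamLtTwo X) : ¬ LocalDiameterTwo X := by
  obtain ⟨f, hf, ε, hε, hd⟩ := h
  exact fun hL => hd.ne (hL f hf ε hε)

/-- A nonzero σ-finite non-atomic measure takes arbitrarily small positive values. -/
theorem IsNonatomic.exists_measure_lt {Ω : Type*} [MeasurableSpace Ω] {μ : Measure Ω}
    [SigmaFinite μ] (h : IsNonatomic μ) (hμ : μ ≠ 0) {r : ℝ≥0∞} (hr : 0 < r) :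
    ∃ A, MeasurableSet A ∧ 0 < μ A ∧ μ A < r ∧ μ A ≠ ∞ := by
  obtain ⟨A₀, hA₀, -, hA₀0, hA₀t⟩ := Measure.exists_subset_measure_lt_top MeasurableSet.univ
    (Measure.measure_univ_pos.2 hμ)
  have key : ∀ n : ℕ, ∃ A, MeasurableSet A ∧ 0 < μ A ∧ μ A ≤ μ A₀ * 2⁻¹ ^ n := by
    intro n
    induction n with
    | zero => exact ⟨A₀, hA₀, hA₀0, by simp⟩
    | succ n ih =>
      obtain ⟨A, hA, hA0, hAn⟩ := ih
      have hAt : μ A ≠ ∞ := ne_top_of_le_ne_top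
        (ENNReal.mul_ne_top hA₀t.ne (by simp)) hAn
      obtain ⟨B, hB, hBA, hB0, hBlt⟩ := h A hA hA0
      have hhalf : μ A / 2 ≤ μ A₀ * 2⁻¹ ^ (n + 1) := by
        rw [pow_succ, ← mul_assoc, div_eq_mul_inv]
        gcongr
      -- One of `B` and `A \ B` has at most half the measure of `A`, and both have positive measure.
      rcases le_total (μ B) (μ A / 2) with hle | hle
      · exact ⟨B, hB, hB0, hle.trans hhalf⟩
      · have hBt : μ B ≠ ∞ := hBlt.ne_top
        have hd : μ (A \ B) = μ A - μ B := measure_sdiff hBA hB.nullMeasurableSet hBt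
        refine ⟨A \ B, hA.diff hB, by rw [hd]; exact tsub_pos_of_lt hBlt, le_trans ?_ hhalf⟩
        rw [hd, tsub_le_iff_right]
        calc μ A = μ A / 2 + μ A / 2 := (ENNReal.add_halves _).symm
          _ ≤ μ A / 2 + μ B := by gcongr
  have hlim : Tendsto (fun n : ℕ => μ A₀ * 2⁻¹ ^ n) atTop (𝓝 0) := by
    have := ENNReal.Tendsto.const_mul (a := μ A₀) (ENNReal.tendsto_pow_atTop_nhds_zero_of_lt_one
      (ENNReal.inv_lt_one.2 (by norm_num : (1 : ℝ≥0∞) < 2))) (Or.inr hA₀t.ne)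
    simpa using this
  obtain ⟨n, hn⟩ := (hlim.eventually_lt_const
    (lt_min hr (ENNReal.zero_lt_top))).exists
  obtain ⟨A, hA, hA0, hAn⟩ := key n
  have hAlt := hAn.trans_lt hn
  exact ⟨A, hA, hA0, hAlt.trans_le (min_le_left _ _), (hAlt.trans_le (min_le_right _ _)).ne⟩

namespace OrliczSpace

variable {φ : OrliczFunction}

theorem hasSliceDiamLtTwo_of_isNonatomic (hfin : φ.IsFinite) (hN : φ.IsNFunctionAtInfty)
    {Ω : Type*} [MeasurableSpace Ω] {μ : Measure Ω} [SigmaFinite μ] (hμ : IsNonatomic μ)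
    (hμ0 : μ ≠ 0) : HasSliceDiamLtTwo (OrliczSpace φ μ) := by
  obtain ⟨d, hd⟩ := WithTop.ne_top_iff_exists.1 (hfin.linearityBound_ne_top hN)
  have hd0 := φ.complementaryReal_nonneg d
  -- This bound gives `ψ(a) = 1 / μ(A) > ψ(d) + 1`, hence `a > d` by monotonicity. The summand `1`
  -- keeps the denominator positive when `ψ(d) = 0`.
  obtain ⟨A, hA, hA0, hAr, hAt⟩ := hμ.exists_measure_lt hμ0
    (r := ENNReal.ofReal (1 / (φ.complementaryReal d + 1))) (ENNReal.ofReal_pos.2 (by positivity))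
  have hAreal : 0 < μ.real A := ENNReal.toReal_pos hA0.ne' hAt
  have hAlt : μ.real A < 1 / (φ.complementaryReal d + 1) :=
    (ENNReal.lt_ofReal_iff_toReal_lt hAt).1 hAr
  obtain ⟨a, ha⟩ := hfin.exists_complementary_eq hN (one_div_nonneg.2 hAreal.le)
  refine hasSliceDiamLtTwo_of_indicator hfin hN hA hAt (a := a) ?_ (by rw [ha]; field_simp)
  refine hd.symm.trans_lt (ENNReal.coe_lt_coe.2 ?_)
  by_contra! hle
  have h1 : φ.complementaryReal a ≤ φ.complementaryReal d :=
    ENNReal.toReal_mono (hN.complementary_ne_top _)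
      (φ.complementary_mono (by simpa using hle))
  rw [ha, div_le_iff₀ hAreal] at h1
  rw [lt_div_iff₀ (by positivity)] at hAlt
  nlinarith

theorem hasSliceDiamLtTwo_count (hfin : φ.IsFinite) (hN : φ.IsNFunctionAtInfty)
    (h : linearityBound (complementary φ.toFun) < unitLevelBound (complementary φ.toFun)) :
    HasSliceDiamLtTwo (OrliczSpace φ (Measure.count : Measure ℕ)) := by
  obtain ⟨u, hu⟩ := lt_iSup_iff.1 h
  obtain ⟨hu1, hlt⟩ := lt_iSup_iff.1 hu
  obtain ⟨a, ha⟩ := hfin.exists_complementary_eq hN (r := 1) zero_le_one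
  have ha' : complementary φ.toFun a = 1 := by
    have := hN.ofReal_complementaryReal a
    rwa [ha, ENNReal.ofReal_one, NNReal.nnnorm_eq, eq_comm] at this
  -- Here `d < u` and `ψ(u) ≤ 1 = ψ(a)`. If `u ≤ a`, then `a` lies beyond `d`; otherwise
  -- monotonicity gives `ψ(u) = 1` and `u` itself serves as the constant.
  rcases le_or_gt u a with hua | hau
  · refine hasSliceDiamLtTwo_of_indicator hfin hN (measurableSet_singleton 0) (by simp)
      (hlt.trans_le (ENNReal.coe_le_coe.2 hua)) ?_
    rw [ha, measureReal_def, Measure.count_singleton]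
    simp
  · refine hasSliceDiamLtTwo_of_indicator hfin hN (measurableSet_singleton 0) (by simp) hlt ?_
    have h1 : complementary φ.toFun u = 1 :=
      le_antisymm hu1 (ha' ▸ φ.complementary_mono hau.le)
    simp [OrliczFunction.complementaryReal, h1, measureReal_def]

end OrliczSpace

theorem mainTheorem9 (φ : OrliczFunction) (hfin : φ.IsFinite) (hN : φ.IsNFunctionAtInfty) :
    (∀ (Ω : Type*) [MeasurableSpace Ω] (μ : Measure Ω) [SigmaFinite μ],
      IsNonatomic μ → μ ≠ 0 →
        HasSliceDiamLtTwo (OrliczSpace φ μ) ∧ ¬ LocalDiameterTwo (OrliczSpace φ μ)) ∧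
    (linearityBound (complementary φ.toFun) < unitLevelBound (complementary φ.toFun) →
      HasSliceDiamLtTwo (OrliczSpace φ (Measure.count : Measure ℕ)) ∧
        ¬ LocalDiameterTwo (OrliczSpace φ (Measure.count : Measure ℕ))) := by
  refine ⟨fun Ω _ μ _ hμ hμ0 => ?_, fun h => ?_⟩
  · have := OrliczSpace.hasSliceDiamLtTwo_of_isNonatomic hfin hN hμ hμ0
    exact ⟨this, this.not_localDiameterTwo⟩
  · have := OrliczSpace.hasSliceDiamLtTwo_count hfin hN h
    exact ⟨this, this.not_localDiameterTwo⟩
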